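/- For integers $p,q\ge 0$ let $\mathrm{Cl}_{p,q}$ be the real Clifford algebra generated by anticommuting elements $e_1,\dots,e_{p+q}$ with $e_j^2=1$ for $1\le j\le p$ and $e_j^2=-1$ for $p+1\le j\le p+q$. Let $G_{p,q}\subseteq \mathrm{Cl}_{p,q}^\times$ be the group of all elements of the form $\pm e_{i_1}e_{i_2}\cdots e_{i_\ell}$ with $\ell\ge 0$ and $1\le i_1<i_2<\dots<i_\ell\le p+q$, with the multiplication of $\mathrm{Cl}_{p,q}$, and let $t=-1\in G_{p,q}$. A real representation $\pi$ of $G_{p,q}$ is called odd if $\pi(t)=-1$. If $p-q \bmod 8$ lies in $\{0,2,3,4,6,7\}$, then $G_{p,q}$ has a unique irreducible odd real representation up to isomorphism; that is, there is a finite-dimensional irreducible odd real representation of $G_{p,q}$, and every irreducible odd real representation of $G_{p,q}$ is isomorphic to it. -/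

import Mathlib

namespace CliffordSigned

/-- The quadratic form `x₁² + ⋯ + x_p² - x_{p+1}² - ⋯ - x_{p+q}²` on `ℝ^(p+q)`. -/
noncomputable def quadForm (p q : ℕ) : QuadraticForm ℝ (Fin (p + q) → ℝ) :=
  QuadraticMap.weightedSumSquares ℝ (fun i : Fin (p + q) => if (i : ℕ) < p then (1 : ℝ) else -1)

/-- The real Clifford algebra `Cl_{p,q}`; here `ι v * ι v = Q v`. -/
abbrev Cl (p q : ℕ) : Type := CliffordAlgebra (quadForm p q)

/-- The Clifford generators (indexed from `0`). -/
noncomputable def e (p q : ℕ) (i : Fin (p + q)) : Cl p q :=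
  CliffordAlgebra.ι (quadForm p q) (Pi.single i 1)

theorem quadForm_single (p q : ℕ) (i : Fin (p + q)) :
    quadForm p q (Pi.single i 1) = if (i : ℕ) < p then (1 : ℝ) else -1 := by
  simp [quadForm, QuadraticMap.weightedSumSquares_apply, Pi.single_apply]

theorem e_mul_self (p q : ℕ) (i : Fin (p + q)) :
    e p q i * e p q i = if (i : ℕ) < p then 1 else -1 := by
  rw [e, CliffordAlgebra.ι_sq_scalar, quadForm_single]
  split_ifs <;> simp

theorem e_anticomm (p q : ℕ) {i j : Fin (p + q)} (h : i ≠ j) :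
    e p q i * e p q j = -(e p q j * e p q i) := by
  rw [eq_neg_iff_add_eq_zero, e, e, CliffordAlgebra.ι_mul_ι_add_swap, QuadraticMap.polar]
  have : quadForm p q (Pi.single i 1 + Pi.single j 1)
      = quadForm p q (Pi.single i 1) + quadForm p q (Pi.single j 1) := by
    simp only [quadForm, QuadraticMap.weightedSumSquares_apply, ← Finset.sum_add_distrib]
    refine Finset.sum_congr rfl fun k _ => ?_
    by_cases h1 : k = i
    · have h2 : k ≠ j := h1 ▸ h
      simp [h1, h]
    · simp [Pi.single_apply, h1]
  rw [this]
  simp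

/-- `x` is a signed monomial: `x = ± e_{i₁} e_{i₂} ⋯ e_{i_ℓ}` with `ℓ ≥ 0` and
`i₁ < i₂ < ⋯ < i_ℓ`. -/
def IsSignedMonomial (p q : ℕ) (x : Cl p q) : Prop :=
  ∃ l : List (Fin (p + q)), l.Pairwise (· < ·) ∧
    (x = (l.map (e p q)).prod ∨ x = -(l.map (e p q)).prod)

variable {p q : ℕ}

theorem IsSignedMonomial.neg {x : Cl p q} (hx : IsSignedMonomial p q x) :
    IsSignedMonomial p q (-x) := by
  obtain ⟨l, hl, rfl | rfl⟩ := hx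
  · exact ⟨l, hl, Or.inr rfl⟩
  · exact ⟨l, hl, Or.inl (neg_neg _)⟩

theorem isSignedMonomial_one : IsSignedMonomial p q 1 := ⟨[], by simp, by simp⟩

theorem e_mul_prod (i : Fin (p + q)) (l : List (Fin (p + q))) (hl : l.Pairwise (· < ·)) :
    ∃ l' : List (Fin (p + q)), l'.Pairwise (· < ·) ∧ (∀ k ∈ l', k = i ∨ k ∈ l) ∧
      (e p q i * (l.map (e p q)).prod = (l'.map (e p q)).prod ∨
        e p q i * (l.map (e p q)).prod = -(l'.map (e p q)).prod) := by
  induction l with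
  | nil => exact ⟨[i], by simp, by simp, by simp⟩
  | cons j l ih =>
    obtain ⟨hj, hl'⟩ := List.pairwise_cons.1 hl
    rcases lt_trichotomy i j with h | h | h
    · refine ⟨i :: j :: l, List.pairwise_cons.2 ⟨?_, hl⟩, by simp, by simp⟩
      intro k hk
      rcases List.mem_cons.1 hk with rfl | hk
      · exact h
      · exact h.trans (hj k hk)
    · subst h
      refine ⟨l, hl', fun k hk => Or.inr (List.mem_cons_of_mem _ hk), ?_⟩
      rw [List.map_cons, List.prod_cons, ← mul_assoc, e_mul_self]
      split_ifs <;> simp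
    · obtain ⟨l', h1, h2, h3⟩ := ih hl'
      refine ⟨j :: l', List.pairwise_cons.2 ⟨?_, h1⟩, ?_, ?_⟩
      · intro k hk
        rcases h2 k hk with rfl | hk
        · exact h
        · exact hj k hk
      · intro k hk
        rcases List.mem_cons.1 hk with rfl | hk
        · simp
        · rcases h2 k hk with h | h <;> simp [h]
      · rw [List.map_cons, List.prod_cons, ← mul_assoc, e_anticomm p q h.ne', neg_mul, mul_assoc,
          List.map_cons, List.prod_cons]
        rcases h3 with h3 | h3 <;> simp [h3]

theorem IsSignedMonomial.e_mul (i : Fin (p + q)) {x : Cl p q} (hx : IsSignedMonomial p q x) :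
    IsSignedMonomial p q (e p q i * x) := by
  obtain ⟨l, hl, h⟩ := hx
  obtain ⟨l', h1, -, h2⟩ := e_mul_prod i l hl
  have : IsSignedMonomial p q (e p q i * (l.map (e p q)).prod) := ⟨l', h1, h2⟩
  rcases h with rfl | rfl
  · exact this
  · rw [mul_neg]
    exact this.neg

theorem IsSignedMonomial.prod_mul (l : List (Fin (p + q))) {x : Cl p q}
    (hx : IsSignedMonomial p q x) : IsSignedMonomial p q ((l.map (e p q)).prod * x) := by
  induction l with
  | nil => simpa using hx
  | cons i l ih =>
    rw [List.map_cons, List.prod_cons, mul_assoc]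
    exact ih.e_mul i

theorem IsSignedMonomial.mul {x y : Cl p q} (hx : IsSignedMonomial p q x)
    (hy : IsSignedMonomial p q y) : IsSignedMonomial p q (x * y) := by
  obtain ⟨l, -, rfl | rfl⟩ := hx
  · exact hy.prod_mul l
  · rw [neg_mul]
    exact (hy.prod_mul l).neg

theorem prod_reverse_mul_prod (l : List (Fin (p + q))) :
    (l.reverse.map (e p q)).prod * (l.map (e p q)).prod = 1 ∨
      (l.reverse.map (e p q)).prod * (l.map (e p q)).prod = -1 := by
  induction l with
  | nil => simp
  | cons i l ih =>
    have : ((i :: l).reverse.map (e p q)).prod * ((i :: l).map (e p q)).prod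
        = (l.reverse.map (e p q)).prod * ((e p q i * e p q i) * (l.map (e p q)).prod) := by
      simp [mul_assoc]
    rw [this, e_mul_self]
    split_ifs
    · simpa using ih
    · rcases ih with ih | ih <;> simp [ih, -List.map_reverse]

theorem IsSignedMonomial.exists_mul_eq_one {x : Cl p q} (hx : IsSignedMonomial p q x) :
    ∃ y, IsSignedMonomial p q y ∧ y * x = 1 := by
  obtain ⟨l, -, h⟩ := hx
  have hy : IsSignedMonomial p q (l.reverse.map (e p q)).prod := by
    simpa using isSignedMonomial_one.prod_mul l.reverse
  rcases h with rfl | rfl <;> rcases prod_reverse_mul_prod l with h' | h'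
  · exact ⟨_, hy, h'⟩
  · exact ⟨_, hy.neg, by simp [h', -List.map_reverse]⟩
  · exact ⟨_, hy.neg, by simp [h', -List.map_reverse]⟩
  · exact ⟨_, hy, by simp [h', -List.map_reverse]⟩

variable (p q)

/-- The group `G_{p,q}` of all signed monomials in the Clifford generators, with the
multiplication of `Cl_{p,q}`. (Every signed monomial is a unit of `Cl_{p,q}`.) -/
noncomputable def G : Subgroup (Cl p q)ˣ where
  carrier := {u | IsSignedMonomial p q (u : Cl p q)}
  one_mem' := isSignedMonomial_one
  mul_mem' hu hv := hu.mul hv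
  inv_mem' {u} hu := by
    obtain ⟨y, hy, h⟩ := hu.exists_mul_eq_one
    have : ((u⁻¹ : (Cl p q)ˣ) : Cl p q) = y := (Units.eq_inv_of_mul_eq_one_right h).symm
    show IsSignedMonomial p q ((u⁻¹ : (Cl p q)ˣ) : Cl p q)
    rwa [this]

/-- The central involution `t = -1` of `G_{p,q}`. -/
noncomputable def t : G p q := ⟨-1, isSignedMonomial_one.neg⟩

variable {p q}

/-- A real representation of a group is odd with respect to the group element `z` if `z` acts as
multiplication by `-1`. -/
def IsOdd {Γ V : Type*} [Group Γ] [AddCommGroup V] [Module ℝ V] (z : Γ)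
    (ρ : Representation ℝ Γ V) : Prop :=
  ρ z = -1

end CliffordSigned

/-! `G p q` spans `Cl p q`, and an odd representation satisfies the Clifford relations, so odd
representations of `G p q` are the same as Clifford modules (`cliffordAction`, `repOfModule`), with
irreducible matching simple. It therefore suffices that `Cl p q` is a simple ring: being
finite-dimensional it is Artinian, and then all its simple modules are isomorphic
(`nonempty_equiv_repOfModule`).

Simplicity (`isSimpleRing_cl`) comes from conjugating by the generators, which sends each monomial
to itself up to sign. A shortest nonzero element of an ideal becomes, after multiplication by a
monomial, a central element `a + bω`, with `ω` the volume element and `b = 0` when `p + q` is even.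
For odd `p + q` the allowed residues are 3 and 7, where `ω² = -1`; so `a + bω` lies in a copy of `ℝ`
or `ℂ` and is invertible. In the excluded residues 1 and 5, `ω² = 1` and the algebra splits. -/

namespace CliffordSigned

/-! ### Commutation signs, central monomials and the square of the volume element -/

section Monomials

variable {p q : ℕ}

theorem neg_one_pow_mul_self (k : ℕ) : (-1 : ℝ) ^ k * (-1) ^ k = 1 := by
  rw [← mul_pow]; simp

theorem e_mul_prod_of_notMem (i : Fin (p + q)) (l : List (Fin (p + q))) (h : i ∉ l) :
    e p q i * (l.map (e p q)).prod = (-1 : ℝ) ^ l.length • ((l.map (e p q)).prod * e p q i) := by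
  induction l with
  | nil => simp
  | cons j l ih =>
    rw [List.mem_cons, not_or] at h
    rw [List.map_cons, List.prod_cons, ← mul_assoc, e_anticomm p q h.1, neg_mul, mul_assoc,
      ih h.2, List.length_cons, pow_succ, mul_smul_comm, mul_assoc]
    simp

/-- `e_i` anticommutes with all but one of the factors. The exponent `l.length + 1` has the parity
of `l.length - 1` and avoids truncated subtraction. -/
theorem e_mul_prod_of_mem (i : Fin (p + q)) (l : List (Fin (p + q))) (hl : l.Nodup) (h : i ∈ l) :
    e p q i * (l.map (e p q)).prod =
      (-1 : ℝ) ^ (l.length + 1) • ((l.map (e p q)).prod * e p q i) := by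
  induction l with
  | nil => simp at h
  | cons j l ih =>
    obtain ⟨hj, hl'⟩ := List.nodup_cons.1 hl
    rw [List.map_cons, List.prod_cons, List.length_cons]
    by_cases hij : i = j
    · subst hij
      rw [pow_succ, pow_succ, mul_assoc ((-1 : ℝ) ^ _), mul_assoc (e p q i), ← mul_smul_comm,
        neg_one_mul, neg_neg, mul_one, ← e_mul_prod_of_notMem i l hj]
    · have hil : i ∈ l := (List.mem_cons.1 h).resolve_left hij
      rw [← mul_assoc, e_anticomm p q hij, neg_mul, mul_assoc, ih hl' hil, pow_succ _ (_ + 1),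
        mul_smul_comm, mul_assoc]
      simp

theorem IsSignedMonomial.e_mul_eq_or (i : Fin (p + q)) {g : Cl p q} (hg : IsSignedMonomial p q g) :
    e p q i * g = g * e p q i ∨ e p q i * g = -(g * e p q i) := by
  obtain ⟨l, hl, hx⟩ := hg
  have key : ∃ k : ℕ, e p q i * (l.map (e p q)).prod =
      (-1 : ℝ) ^ k • ((l.map (e p q)).prod * e p q i) := by
    by_cases h : i ∈ l
    · exact ⟨_, e_mul_prod_of_mem i l (hl.imp fun h => h.ne) h⟩
    · exact ⟨_, e_mul_prod_of_notMem i l h⟩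
  obtain ⟨k, hk⟩ := key
  rcases neg_one_pow_eq_or ℝ k with h | h <;> rw [h] at hk <;>
    rcases hx with rfl | rfl <;> simp [hk]

theorem isSignedMonomial_e (i : Fin (p + q)) : IsSignedMonomial p q (e p q i) := by
  simpa using isSignedMonomial_one.e_mul i

theorem IsSignedMonomial.ne_zero {g : Cl p q} (hg : IsSignedMonomial p q g) : g ≠ 0 := by
  rintro rfl
  obtain ⟨y, -, h⟩ := hg.exists_mul_eq_one
  simp at h

theorem IsSignedMonomial.exists_inverse {g : Cl p q} (hg : IsSignedMonomial p q g) :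
    ∃ y, IsSignedMonomial p q y ∧ y * g = 1 ∧ g * y = 1 := by
  obtain ⟨y, hy, h⟩ := hg.exists_mul_eq_one
  obtain ⟨z, -, h'⟩ := hy.exists_mul_eq_one
  have : z = g := by rw [← mul_one z, ← h, ← mul_assoc, h', one_mul]
  exact ⟨y, hy, h, this ▸ h'⟩

/-- The volume element `e₁ e₂ ⋯ e_{p+q}`. -/
noncomputable def volumeElement (p q : ℕ) : Cl p q :=
  ((List.finRange (p + q)).map (e p q)).prod

/-- By the two sign rules, a monomial of even length anticommutes with each generator it contains,
and one of odd length with each generator it omits. A central monomial is thus empty, or full of odd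
length. -/
theorem IsSignedMonomial.eq_of_commute {g : Cl p q} (hg : IsSignedMonomial p q g)
    (hc : ∀ i, e p q i * g = g * e p q i) :
    g = 1 ∨ g = -1 ∨ (Odd (p + q) ∧ (g = volumeElement p q ∨ g = -volumeElement p q)) := by
  obtain ⟨l, hl, hx⟩ := hg
  have hP : IsSignedMonomial p q (l.map (e p q)).prod := ⟨l, hl, Or.inl rfl⟩
  have hnd : l.Nodup := hl.imp fun h => h.ne
  have hc' : ∀ i, e p q i * (l.map (e p q)).prod = (l.map (e p q)).prod * e p q i := by
    rcases hx with rfl | rfl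
    · exact hc
    · simpa using hc
  have even_of : ∀ i k, e p q i * (l.map (e p q)).prod =
      (-1 : ℝ) ^ k • ((l.map (e p q)).prod * e p q i) → Even k := by
    intro i k h
    by_contra hk
    rw [Nat.not_even_iff_odd] at hk
    rw [hk.neg_one_pow, hc' i, neg_one_smul, eq_neg_iff_add_eq_zero, ← two_smul ℝ] at h
    exact (hP.mul (isSignedMonomial_e i)).ne_zero (by simpa using h)
  rcases Nat.even_or_odd l.length with hk | hk
  · have hnil : l = [] := by
      rw [List.eq_nil_iff_forall_not_mem]
      intro i hi
      have := even_of i _ (e_mul_prod_of_mem i l hnd hi)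
      exact Nat.not_even_iff_odd.2 hk.add_one this
    subst hnil
    simp only [List.map_nil, List.prod_nil] at hx
    tauto
  · have hmem : ∀ i, i ∈ l := by
      intro i
      by_contra hi
      exact Nat.not_even_iff_odd.2 hk (even_of i _ (e_mul_prod_of_notMem i l hi))
    -- A strictly increasing list is determined by its set of entries.
    have hl' : l = List.finRange (p + q) :=
      List.Perm.eq_of_pairwise (le := (· < ·)) (fun a b _ _ h h' => absurd h h'.asymm)
        hl (List.pairwise_lt_finRange _)
        ((List.perm_ext_iff_of_nodup hnd (List.nodup_finRange _)).2 (by simp [hmem]))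
    subst hl'
    rw [List.length_finRange] at hk
    exact Or.inr (Or.inr ⟨hk, hx⟩)

/-- Moving `e_i` back across a tail of length `k` costs `(-1)^k`; these exponents add up to `0 + 1 +
⋯ + (n - 1)`. -/
theorem prod_mul_prod_self (l : List (Fin (p + q))) (hl : l.Nodup) :
    (l.map (e p q)).prod * (l.map (e p q)).prod =
      algebraMap ℝ _ ((-1 : ℝ) ^ (∑ k ∈ Finset.range l.length, k) *
        (l.map fun i : Fin (p + q) => if (i : ℕ) < p then (1 : ℝ) else -1).prod) := by
  induction l with
  | nil => simp
  | cons i l ih =>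
    obtain ⟨hi, hl'⟩ := List.nodup_cons.1 hl
    have h := e_mul_prod_of_notMem i l hi
    have h' : (l.map (e p q)).prod * e p q i =
        (-1 : ℝ) ^ l.length • (e p q i * (l.map (e p q)).prod) := by
      rw [h, smul_smul, neg_one_pow_mul_self, one_smul]
    have hsq : e p q i * e p q i = algebraMap ℝ _ (if (i : ℕ) < p then (1 : ℝ) else -1) := by
      rw [e_mul_self]; split_ifs <;> simp
    rw [List.map_cons, List.prod_cons, mul_assoc, ← mul_assoc _ (e p q i), h', smul_mul_assoc,
      mul_smul_comm, mul_assoc, ih hl', ← mul_assoc, hsq, ← map_mul, Algebra.smul_def, ← map_mul,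
      List.length_cons, Finset.sum_range_succ, pow_add, List.map_cons, List.prod_cons]
    congr 1
    ring

theorem volumeElement_mul_self :
    volumeElement p q * volumeElement p q =
      algebraMap ℝ _ ((-1 : ℝ) ^ ((p + q) * (p + q - 1) / 2 + q)) := by
  rw [volumeElement, prod_mul_prod_self _ (List.nodup_finRange _), List.length_finRange,
    Finset.sum_range_id, ← List.ofFn_eq_map, List.prod_ofFn, Fin.prod_univ_add, pow_add]
  simp

theorem span_isSignedMonomial :
    Submodule.span ℝ {x | IsSignedMonomial p q x} = ⊤ := by
  rw [eq_top_iff]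
  rintro x -
  induction x using CliffordAlgebra.induction with
  | algebraMap r =>
    rw [Algebra.algebraMap_eq_smul_one]
    exact Submodule.smul_mem _ _ (Submodule.subset_span isSignedMonomial_one)
  | ι v =>
    rw [pi_eq_sum_univ' v, map_sum]
    refine Submodule.sum_mem _ fun i _ => ?_
    rw [map_smul]
    refine Submodule.smul_mem _ _ (Submodule.subset_span ?_)
    exact isSignedMonomial_e i
  | mul a b ha hb =>
    have := Submodule.mul_mem_mul ha hb
    rw [Submodule.span_mul_span] at this
    refine Submodule.span_mono ?_ this
    rintro _ ⟨x, hx, y, hy, rfl⟩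
    exact IsSignedMonomial.mul hx hy
  | add a b ha hb => exact Submodule.add_mem _ ha hb

theorem finite_isSignedMonomial : {x | IsSignedMonomial p q x}.Finite := by
  have hl : {l : List (Fin (p + q)) | l.Pairwise (· < ·)}.Finite := by
    refine (List.finite_length_le (Fin (p + q)) (p + q)).subset fun l hl => ?_
    have : l.Nodup := List.Pairwise.imp (fun h => h.ne) hl
    simpa using this.length_le_card
  refine ((hl.image fun l => (l.map (e p q)).prod).union
    (hl.image fun l => -(l.map (e p q)).prod)).subset ?_
  rintro x ⟨l, hl, rfl | rfl⟩
  · exact Or.inl ⟨l, hl, rfl⟩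
  · exact Or.inr ⟨l, hl, rfl⟩

instance finiteDimensional_cl : FiniteDimensional ℝ (Cl p q) :=
  Module.finite_def.2 (Submodule.fg_def.2 ⟨_, finite_isSignedMonomial, span_isSignedMonomial⟩)

end Monomials
-- Simplicity of the Clifford algebra
section Simple

variable {p q : ℕ}

theorem exists_sum_smul_eq (x : Cl p q) :
    ∃ (S : Finset (Cl p q)) (c : Cl p q → ℝ), (∀ g ∈ S, IsSignedMonomial p q g) ∧
      x = ∑ g ∈ S, c g • g := by
  have hx : x ∈ Submodule.span ℝ {x | IsSignedMonomial p q x} := by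
    rw [span_isSignedMonomial]; trivial
  obtain ⟨c, S, hS, -, h⟩ := Submodule.mem_span_iff_exists_finset_subset.1 hx
  exact ⟨S, c, fun g hg => hS hg, h.symm⟩

/-- A nonzero two-sided ideal contains a nonzero combination of signed monomials all of which
commute with the generators up to a common sign: take one with the fewest terms. -/
theorem exists_mem_sum_smul_of_ne_bot (I : TwoSidedIdeal (Cl p q)) (hI : I ≠ ⊥) :
    ∃ (S : Finset (Cl p q)) (c : Cl p q → ℝ), (∀ g ∈ S, IsSignedMonomial p q g) ∧
      (∑ g ∈ S, c g • g) ∈ I ∧ (∑ g ∈ S, c g • g) ≠ 0 ∧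
      ∀ i, (∀ g ∈ S, e p q i * g = g * e p q i) ∨ (∀ g ∈ S, e p q i * g = -(g * e p q i)) := by
  classical
  let P : ℕ → Prop := fun k => ∃ (S : Finset (Cl p q)) (c : Cl p q → ℝ), S.card = k ∧
    (∀ g ∈ S, IsSignedMonomial p q g) ∧ (∑ g ∈ S, c g • g) ∈ I ∧ (∑ g ∈ S, c g • g) ≠ 0
  have hP : ∃ k, P k := by
    obtain ⟨x, hxI, hx⟩ := SetLike.exists_of_lt (bot_lt_iff_ne_bot.2 hI)
    obtain ⟨S, c, hS, rfl⟩ := exists_sum_smul_eq x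
    exact ⟨_, S, c, rfl, hS, hxI, hx⟩
  obtain ⟨S, c, hk, hS, hxI, hx⟩ := Nat.find_spec hP
  refine ⟨S, c, hS, hxI, hx, fun i => ?_⟩
  by_contra! hcon
  obtain ⟨⟨g₁, hg₁, hne₁⟩, g₂, hg₂, hne₂⟩ := hcon
  have vanish : ∀ (T : Finset (Cl p q)) (d : Cl p q → ℝ), T ⊂ S →
      (∑ g ∈ T, d g • g) ∈ I → ∑ g ∈ T, d g • g = 0 := by
    intro T d hT hmem
    by_contra h0
    exact Nat.find_min hP (hk ▸ Finset.card_lt_card hT)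
      ⟨T, d, rfl, fun g hg => hS g (hT.1 hg), hmem, h0⟩
  obtain ⟨u, -, -, hu⟩ := (isSignedMonomial_e i).exists_inverse
  set x := ∑ g ∈ S, c g • g with hxdef
  have hconj : e p q i * x * u ∈ I := I.mul_mem_right _ _ (I.mul_mem_left _ _ hxI)
  -- Conjugation by `e_i` fixes the commuting terms and negates the others, so `x` plus or minus its
  -- conjugate doubles one kind and kills the other. Each result is shorter than `x`, hence zero by
  -- minimality.
  have hplus : x + e p q i * x * u =
      ∑ g ∈ S with e p q i * g = g * e p q i, (2 * c g) • g := by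
    rw [hxdef, Finset.mul_sum, Finset.sum_mul, ← Finset.sum_add_distrib, Finset.sum_filter]
    refine Finset.sum_congr rfl fun g hg => ?_
    rw [mul_smul_comm, smul_mul_assoc]
    split_ifs with h
    · rw [h, mul_assoc, hu, mul_one, ← add_smul, two_mul]
    · rw [((hS g hg).e_mul_eq_or i).resolve_left h, neg_mul, mul_assoc, hu, mul_one, smul_neg,
        add_neg_cancel]
  have hminus : x - e p q i * x * u =
      ∑ g ∈ S with ¬ e p q i * g = g * e p q i, (2 * c g) • g := by
    rw [hxdef, Finset.mul_sum, Finset.sum_mul, ← Finset.sum_sub_distrib, Finset.sum_filter]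
    refine Finset.sum_congr rfl fun g hg => ?_
    rw [mul_smul_comm, smul_mul_assoc]
    split_ifs with h
    · rw [h, mul_assoc, hu, mul_one, sub_self]
    · rw [((hS g hg).e_mul_eq_or i).resolve_left h, neg_mul, mul_assoc, hu, mul_one, smul_neg,
        sub_neg_eq_add, ← add_smul, two_mul]
  have h₁ : x + e p q i * x * u = 0 := by
    rw [hplus]
    exact vanish _ _ (Finset.filter_ssubset.2 ⟨g₁, hg₁, hne₁⟩) (hplus ▸ I.add_mem hxI hconj)
  have h₂ : x - e p q i * x * u = 0 := by
    rw [hminus]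
    exact vanish _ _ (Finset.filter_ssubset.2 ⟨g₂, hg₂, not_not.2
      (((hS g₂ hg₂).e_mul_eq_or i).resolve_right hne₂)⟩) (hminus ▸ I.sub_mem hxI hconj)
  refine hx ?_
  have h₃ : (2 : ℝ) • x = 0 := by
    rw [two_smul, ← add_zero (0 : Cl p q)]
    nth_rewrite 1 [← h₁]
    rw [← h₂]
    abel
  simpa using h₃

/-- Multiplying by the inverse `y` of one term cancels the common signs and makes every term
central. The result `a + bω` has the conjugate `a - bω`, with product the nonzero real `a² + b²`. -/
theorem isSimpleRing_cl (hω : Odd (p + q) → volumeElement p q * volumeElement p q = -1) :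
    IsSimpleRing (Cl p q) := by
  refine IsSimpleRing.of_eq_bot_or_eq_top fun I => or_iff_not_imp_left.2 fun hI => ?_
  obtain ⟨S, c, hS, hxI, hx, hsign⟩ := exists_mem_sum_smul_of_ne_bot I hI
  obtain ⟨g₀, hg₀⟩ : S.Nonempty := by
    rw [Finset.nonempty_iff_ne_empty]
    rintro rfl
    simp at hx
  obtain ⟨y, hy, hyg, hgy⟩ := (hS g₀ hg₀).exists_inverse
  have hcomm : ∀ g ∈ S, ∀ i, e p q i * (y * g) = y * g * e p q i := by
    intro g hg i
    -- The inverse of `g₀` has the same commutation sign with `e_i` as `g₀`.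
    have hy' : ∀ s : ℝ, s * s = 1 → e p q i * g₀ = s • (g₀ * e p q i) →
        e p q i * y = s • (y * e p q i) := by
      intro s hs h
      calc e p q i * y = y * (g₀ * e p q i) * y := by rw [← mul_assoc y, hyg, one_mul]
        _ = s • (y * (s • (g₀ * e p q i)) * y) := by
          rw [mul_smul_comm, smul_mul_assoc, smul_smul, hs, one_smul]
        _ = s • (y * e p q i) := by rw [← h, mul_assoc, mul_assoc _ g₀, hgy, mul_one]
    rcases hsign i with h | h
    · have := hy' 1 (by norm_num) (by simpa using h g₀ hg₀)
      rw [← mul_assoc, this, one_smul, mul_assoc, h g hg, mul_assoc]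
    · have := hy' (-1) (by norm_num) (by simpa using h g₀ hg₀)
      rw [← mul_assoc, this, neg_one_smul, neg_mul, mul_assoc, h g hg, mul_neg, neg_neg,
        mul_assoc]
  obtain ⟨a, b, hab, hb⟩ : ∃ a b : ℝ, y * ∑ g ∈ S, c g • g = a • 1 + b • volumeElement p q ∧
      (b = 0 ∨ volumeElement p q * volumeElement p q = -1) := by
    have hterm : ∀ g ∈ S, ∃ a b : ℝ, y * g = a • 1 + b • volumeElement p q ∧
        (b = 0 ∨ Odd (p + q)) := by
      intro g hg
      rcases (hy.mul (hS g hg)).eq_of_commute (hcomm g hg) with h | h | ⟨ho, h | h⟩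
      · exact ⟨1, 0, by simp [h], Or.inl rfl⟩
      · exact ⟨-1, 0, by simp [h], Or.inl rfl⟩
      · exact ⟨0, 1, by simp [h], Or.inr ho⟩
      · exact ⟨0, -1, by simp [h], Or.inr ho⟩
    choose! a b hab hb using hterm
    refine ⟨∑ g ∈ S, c g * a g, ∑ g ∈ S, c g * b g, ?_, ?_⟩
    · rw [Finset.mul_sum, Finset.sum_smul, Finset.sum_smul, ← Finset.sum_add_distrib]
      refine Finset.sum_congr rfl fun g hg => ?_
      rw [mul_smul_comm, hab g hg, smul_add, smul_smul, smul_smul]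
    · by_cases ho : Odd (p + q)
      · exact Or.inr (hω ho)
      · exact Or.inl (Finset.sum_eq_zero fun g hg => by rw [(hb g hg).resolve_right ho, mul_zero])
  have hmem : y * ∑ g ∈ S, c g • g ∈ I := I.mul_mem_left _ _ hxI
  have hne : y * ∑ g ∈ S, c g • g ≠ 0 := by
    intro h
    apply hx
    rw [← one_mul (∑ g ∈ S, c g • g), ← hgy, mul_assoc, h, mul_zero]
  rw [hab] at hmem hne
  have hnorm : (a • (1 : Cl p q) + b • volumeElement p q) * (a • 1 - b • volumeElement p q) =
      (a * a + b * b) • 1 := by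
    rcases hb with rfl | hb
    · simp [smul_smul]
    · simp only [add_mul, mul_sub, smul_mul_smul_comm, hb, one_mul, mul_one, smul_neg, add_smul,
        mul_comm b a]
      abel
  have hab0 : a * a + b * b ≠ 0 := by
    intro h
    obtain ⟨rfl, rfl⟩ := (mul_self_add_mul_self_eq_zero).1 h
    simp at hne
  have hone : (1 : Cl p q) = (a • 1 + b • volumeElement p q) * (a • 1 - b • volumeElement p q) *
      algebraMap ℝ _ (a * a + b * b)⁻¹ := by
    rw [hnorm, ← Algebra.algebraMap_eq_smul_one, ← map_mul, mul_inv_cancel₀ hab0, map_one]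
  rw [← I.one_mem_iff, hone]
  exact I.mul_mem_right _ _ (I.mul_mem_right _ _ hmem)

end Simple

/-! ### Odd representations and Clifford modules -/

section Representations

variable {p q : ℕ}

/-- Every Clifford module restricts to a representation of `G_{p,q}`. -/
noncomputable def repOfModule (p q : ℕ) (W : Type*) [AddCommGroup W] [Module ℝ W]
    [Module (Cl p q) W] [IsScalarTower ℝ (Cl p q) W] : Representation ℝ (G p q) W :=
  (Algebra.lsmul ℝ ℝ W : Cl p q →ₐ[ℝ] Module.End ℝ W).toMonoidHom.comp
    ((Units.coeHom _).comp (G p q).subtype)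

theorem repOfModule_apply {W : Type*} [AddCommGroup W] [Module ℝ W]
    [Module (Cl p q) W] [IsScalarTower ℝ (Cl p q) W] (g : G p q) (w : W) :
    repOfModule p q W g w = ((g : (Cl p q)ˣ) : Cl p q) • w := rfl

theorem isOdd_repOfModule {W : Type*} [AddCommGroup W] [Module ℝ W]
    [Module (Cl p q) W] [IsScalarTower ℝ (Cl p q) W] : IsOdd (t p q) (repOfModule p q W) := by
  ext w
  rw [repOfModule_apply]
  simp [t]

theorem IsSignedMonomial.exists_coe_eq {x : Cl p q} (hx : IsSignedMonomial p q x) :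
    ∃ g : G p q, ((g : (Cl p q)ˣ) : Cl p q) = x := by
  obtain ⟨y, -, h, h'⟩ := hx.exists_inverse
  exact ⟨⟨⟨x, y, h', h⟩, hx⟩, rfl⟩

/-- Clifford submodules are the same as subrepresentations for `G_{p,q}`, as `G_{p,q}` spans
`Cl_{p,q}`. -/
noncomputable def submoduleOrderIso {W : Type*} [AddCommGroup W] [Module ℝ W]
    [Module (Cl p q) W] [IsScalarTower ℝ (Cl p q) W] :
    Submodule (Cl p q) W ≃o Subrepresentation (repOfModule p q W) where
  toFun N := ⟨N.restrictScalars ℝ, fun _ _ hv => N.smul_mem _ hv⟩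
  invFun N :=
    { N.toSubmodule with
      smul_mem' := fun x w hw => by
        have hx : x ∈ Submodule.span ℝ {x | IsSignedMonomial p q x} := by
          rw [span_isSignedMonomial]; trivial
        change x • w ∈ N.toSubmodule
        induction hx using Submodule.span_induction with
        | mem x hx =>
          obtain ⟨g, rfl⟩ := hx.exists_coe_eq
          exact N.apply_mem_toSubmodule g hw
        | zero => rw [zero_smul]; exact N.toSubmodule.zero_mem
        | add x y _ _ hx hy => rw [add_smul]; exact N.toSubmodule.add_mem hx hy
        | smul a x _ hx => rw [smul_assoc]; exact N.toSubmodule.smul_mem a hx }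
  left_inv _ := rfl
  right_inv _ := rfl
  map_rel_iff' := Iff.rfl

theorem isIrreducible_repOfModule_iff {W : Type*} [AddCommGroup W] [Module ℝ W]
    [Module (Cl p q) W] [IsScalarTower ℝ (Cl p q) W] :
    (repOfModule p q W).IsIrreducible ↔ IsSimpleModule (Cl p q) W := by
  rw [isSimpleModule_iff]
  exact submoduleOrderIso.symm.isSimpleOrder_iff

/-- The generator `e_i` as an element of `G_{p,q}`. -/
noncomputable def generator (i : Fin (p + q)) : G p q :=
  (isSignedMonomial_e i).exists_coe_eq.choose

theorem coe_generator (i : Fin (p + q)) : ((generator i : (Cl p q)ˣ) : Cl p q) = e p q i :=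
  (isSignedMonomial_e i).exists_coe_eq.choose_spec

theorem coe_injective : Function.Injective fun g : G p q => ((g : (Cl p q)ˣ) : Cl p q) :=
  Units.val_injective.comp Subtype.val_injective

theorem coe_t : ((t p q : (Cl p q)ˣ) : Cl p q) = -1 := rfl

theorem generator_mul_self (i : Fin (p + q)) :
    generator i * generator i = if (i : ℕ) < p then 1 else t p q := by
  apply coe_injective
  have := e_mul_self p q i
  split_ifs at this ⊢ <;> simpa [coe_generator, coe_t] using this

theorem generator_mul_generator {i j : Fin (p + q)} (h : i ≠ j) :
    generator i * generator j = t p q * (generator j * generator i) := by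
  apply coe_injective
  simpa [coe_generator, coe_t] using e_anticomm p q h

theorem exists_eq_prod_generator (g : G p q) :
    ∃ l : List (Fin (p + q)), g = (l.map generator).prod ∨ g = t p q * (l.map generator).prod := by
  have hl : ∀ l : List (Fin (p + q)),
      (((l.map generator).prod : G p q) : (Cl p q)ˣ).val = (l.map (e p q)).prod := by
    intro l
    induction l with
    | nil => rfl
    | cons i l ih =>
      rw [List.map_cons, List.prod_cons, Subgroup.coe_mul, Units.val_mul, ih, coe_generator,
        List.map_cons, List.prod_cons]
  obtain ⟨l, -, h⟩ := g.2
  refine ⟨l, h.imp (fun h => coe_injective ?_) (fun h => coe_injective ?_)⟩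
  · exact h.trans (hl l).symm
  · simp only [Subgroup.coe_mul, Units.val_mul, coe_t, hl, h, neg_one_mul]

variable {W : Type*} [AddCommGroup W] [Module ℝ W] {σ : Representation ℝ (G p q) W}

/-- The action of the vectors of `ℝ^(p+q)` determined by an odd representation. -/
noncomputable def vectorAction (σ : Representation ℝ (G p q) W) :
    (Fin (p + q) → ℝ) →ₗ[ℝ] Module.End ℝ W :=
  Fintype.linearCombination ℝ fun i => σ (generator i)

theorem vectorAction_mul_self (hσ : IsOdd (t p q) σ) (v : Fin (p + q) → ℝ) :
    vectorAction σ v * vectorAction σ v = algebraMap ℝ _ (quadForm p q v) := by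
  have hanti : ∀ i j, σ (generator i) * σ (generator j) + σ (generator j) * σ (generator i) =
      if i = j then (2 * if (i : ℕ) < p then (1 : ℝ) else -1) • 1 else 0 := by
    intro i j
    by_cases h : i = j
    · subst h
      rw [if_pos rfl, ← map_mul, generator_mul_self]
      split_ifs
      · rw [map_one, ← two_smul ℝ, mul_one]
      · rw [hσ, ← two_smul ℝ]; simp
    · rw [if_neg h, ← map_mul, generator_mul_generator h, map_mul, hσ, map_mul]
      simp
  have hexp : vectorAction σ v * vectorAction σ v =
      ∑ i, ∑ j, (v i * v j) • (σ (generator i) * σ (generator j)) := by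
    simp only [vectorAction, Fintype.linearCombination_apply, Finset.sum_mul_sum,
      smul_mul_smul_comm]
  -- Averaging the two expansions leaves only anticommutators, whose off-diagonal terms vanish.
  have hswap : vectorAction σ v * vectorAction σ v =
      ∑ i, ∑ j, (v i * v j) • (σ (generator j) * σ (generator i)) := by
    rw [hexp, Finset.sum_comm]
    exact Finset.sum_congr rfl fun i _ => Finset.sum_congr rfl fun j _ => by rw [mul_comm (v j)]
  have htwice : (2 : ℝ) • (vectorAction σ v * vectorAction σ v) =
      (2 : ℝ) • algebraMap ℝ (Module.End ℝ W) (quadForm p q v) := by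
    rw [two_smul]
    nth_rewrite 2 [hswap]
    rw [hexp]
    simp_rw [← Finset.sum_add_distrib, ← smul_add, hanti]
    simp only [smul_ite, smul_zero, Finset.sum_ite_eq, Finset.mem_univ, if_true, quadForm,
      QuadraticMap.weightedSumSquares_apply, Algebra.algebraMap_eq_smul_one, Finset.sum_smul,
      Finset.smul_sum, smul_smul]
    refine Finset.sum_congr rfl fun i _ => ?_
    rw [smul_eq_mul]
    congr 1
    ring
  exact smul_right_injective _ (two_ne_zero (α := ℝ)) htwice

/-- The action of the Clifford algebra determined by an odd representation of `G_{p,q}`. -/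
noncomputable def cliffordAction (hσ : IsOdd (t p q) σ) : Cl p q →ₐ[ℝ] Module.End ℝ W :=
  CliffordAlgebra.lift _ ⟨vectorAction σ, vectorAction_mul_self hσ⟩

theorem cliffordAction_coe (hσ : IsOdd (t p q) σ) (g : G p q) :
    cliffordAction hσ ((g : (Cl p q)ˣ) : Cl p q) = σ g := by
  have he : ∀ i, cliffordAction hσ (e p q i) = σ (generator i) := by
    intro i
    rw [cliffordAction, e, CliffordAlgebra.lift_ι_apply, vectorAction,
      Fintype.linearCombination_apply_single, one_smul]
  let φ : G p q →* Module.End ℝ W :=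
    (cliffordAction hσ).toMonoidHom.comp ((Units.coeHom _).comp (G p q).subtype)
  have hφ : ∀ l : List (Fin (p + q)),
      φ (l.map generator).prod = σ (l.map generator).prod := by
    intro l
    induction l with
    | nil => simp
    | cons i l ih =>
      rw [List.map_cons, List.prod_cons, map_mul, map_mul, ih]
      congr 1
      exact (congrArg _ (coe_generator i)).trans (he i)
  change φ g = σ g
  obtain ⟨l, rfl | rfl⟩ := exists_eq_prod_generator g
  · exact hφ l
  · rw [map_mul, map_mul, hφ, hσ]
    congr 1
    exact (map_neg (cliffordAction hσ) 1).trans (by rw [map_one])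

end Representations

theorem volumeElement_mul_self_eq_neg_one {p q : ℕ}
    (hpq : (p : ZMod 8) - (q : ZMod 8) ∈ ({0, 2, 3, 4, 6, 7} : Set (ZMod 8)))
    (ho : Odd (p + q)) : volumeElement p q * volumeElement p q = -1 := by
  -- Odd `p + q` rules out the even residues; 3 and 7 agree modulo 4.
  have hmod : p % 4 = (q + 3) % 4 := by
    have h8 : p % 8 = (q + 3) % 8 ∨ p % 8 = (q + 7) % 8 := by
      simp only [Set.mem_insert_iff, Set.mem_singleton_iff, sub_eq_iff_eq_add'] at hpq
      have key : ∀ k : ℕ, (p : ZMod 8) = q + (k : ℕ) → p % 8 = (q + k) % 8 := by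
        intro k h
        exact (ZMod.natCast_eq_natCast_iff' _ _ _).1 (by push_cast; exact h)
      obtain ⟨m, hm⟩ := ho
      rcases hpq with h | h | h | h | h | h
      · have := key 0 (by exact_mod_cast h); omega
      · have := key 2 (by exact_mod_cast h); omega
      · exact Or.inl (key 3 (by exact_mod_cast h))
      · have := key 4 (by exact_mod_cast h); omega
      · have := key 6 (by exact_mod_cast h); omega
      · exact Or.inr (key 7 (by exact_mod_cast h))
    omega
  obtain ⟨m, hm⟩ := ho
  have hdiv : (p + q) * (p + q - 1) / 2 = (2 * m + 1) * m := by
    rw [hm, Nat.add_sub_cancel, mul_left_comm, Nat.mul_div_cancel_left _ two_pos]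
  have hodd : Odd ((p + q) * (p + q - 1) / 2 + q) := by
    -- Substituting `p ≡ q + 3` into `p + q = 2m + 1` gives `2(m - q) ≡ 2` modulo 4.
    have hmq : Odd (m + q) := by
      rw [Nat.odd_iff]; omega
    have : (2 * m + 1) * m + q = 2 * (m * m) + (m + q) := by ring
    rw [hdiv, this]
    exact (even_two_mul _).add_odd hmq
  rw [volumeElement_mul_self, hodd.neg_one_pow, map_neg, map_one]

end CliffordSigned

open CliffordSigned in
theorem CliffordSigned.nonempty_equiv_repOfModule {p q : ℕ} [IsSimpleRing (Cl p q)]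
    {V W : Type*} [AddCommGroup V] [Module ℝ V] [Module (Cl p q) V] [IsScalarTower ℝ (Cl p q) V]
    [IsSimpleModule (Cl p q) V] [AddCommGroup W] [Module ℝ W] {σ : Representation ℝ (G p q) W}
    (hσ : σ.IsIrreducible) (hodd : IsOdd (t p q) σ) :
    Nonempty (Representation.Equiv (repOfModule p q V) σ) := by
  have : IsArtinianRing (Cl p q) := IsArtinianRing.of_finite ℝ _
  let _ : Module (Cl p q) W := Module.compHom W (cliffordAction hodd).toRingHom
  have hsmul : ∀ (x : Cl p q) (w : W), x • w = cliffordAction hodd x w := fun _ _ => rfl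
  have : IsScalarTower ℝ (Cl p q) W :=
    ⟨fun r x w => by rw [hsmul, hsmul, map_smul, LinearMap.smul_apply]⟩
  have hrep : repOfModule p q W = σ := by
    ext g w
    rw [repOfModule_apply, hsmul, cliffordAction_coe]
  have : IsSimpleModule (Cl p q) W := isIrreducible_repOfModule_iff.1 (hrep ▸ hσ)
  -- Both simple modules are realised as left ideals; these are isomorphic because the regular
  -- module of a simple Artinian ring is isotypic.
  obtain ⟨I, ⟨f⟩⟩ := IsSemisimpleRing.exists_linearEquiv_ideal_of_isSimpleModule (Cl p q) V
  obtain ⟨J, ⟨f'⟩⟩ := IsSemisimpleRing.exists_linearEquiv_ideal_of_isSimpleModule (Cl p q) W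
  have := IsSimpleModule.congr f.symm
  have := IsSimpleModule.congr f'.symm
  obtain ⟨k⟩ := IsSimpleRing.isIsotypic (Cl p q) (Cl p q) J I
  let E : V ≃ₗ[Cl p q] W := f.trans (k.trans f'.symm)
  refine ⟨Representation.Equiv.mk (E.restrictScalars ℝ) fun g => ?_⟩
  rw [← hrep]
  ext v
  exact E.map_smul _ v

theorem proposition2p7 (p q : ℕ)
    (hpq : (p : ZMod 8) - (q : ZMod 8) ∈ ({0, 2, 3, 4, 6, 7} : Set (ZMod 8))) :
    ∃ (V : Type) (_ : AddCommGroup V) (_ : Module ℝ V)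
      (ρ : Representation ℝ (CliffordSigned.G p q) V),
      FiniteDimensional ℝ V ∧ ρ.IsIrreducible ∧ CliffordSigned.IsOdd (CliffordSigned.t p q) ρ ∧
      ∀ (W : Type*) [AddCommGroup W] [Module ℝ W]
        (σ : Representation ℝ (CliffordSigned.G p q) W),
        σ.IsIrreducible → CliffordSigned.IsOdd (CliffordSigned.t p q) σ →
          Nonempty (Representation.Equiv ρ σ) := by
  have := CliffordSigned.isSimpleRing_cl (CliffordSigned.volumeElement_mul_self_eq_neg_one hpq)
  have : IsArtinianRing (CliffordSigned.Cl p q) := IsArtinianRing.of_finite ℝ _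
  -- The representation is carried by a minimal left ideal.
  obtain ⟨S, hS⟩ := IsSemisimpleModule.exists_simple_submodule (CliffordSigned.Cl p q)
    (CliffordSigned.Cl p q)
  exact ⟨S, inferInstance, inferInstance, CliffordSigned.repOfModule p q S,
    Module.Finite.of_injective (S.subtype.restrictScalars ℝ) S.subtype_injective,
    CliffordSigned.isIrreducible_repOfModule_iff.2 hS, CliffordSigned.isOdd_repOfModule,
    fun W _ _ σ hσ hodd => CliffordSigned.nonempty_equiv_repOfModule hσ hodd⟩
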